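/- Consider a clustered distributed storage system with $n$ nodes of storage capacity $\alpha\ge 0$ each, divided into $L$ clusters of $n_I=n/L$ nodes, and let $1\le k<n$. A failed node is repaired with the help of all the other $n-1$ nodes: each of the $n_I-1$ nodes of its own cluster sends $\beta_I\ge 0$ symbols and each of the $n-n_I$ nodes of other clusters sends $\beta_c=\epsilon\beta_I$ symbols, so that the repair bandwidth is $\gamma=(n_I-1)\beta_I+(n-n_I)\beta_c$. Let the capacity $\mathcal C(\alpha,\gamma)$ be the maximum amount of data that can be reliably retrieved by contacting arbitrary $k$ nodes, that is, the minimum, over all finite sequences of failures and repairs and all choices of $k$ contacted nodes, of the minimum cut between source and data collector in the resulting information flow graph. For given $\epsilon$ and file size $\mathcal M>0$, the minimum-storage-regenerating (MSR) point is the pair $(\alpha,\gamma)$ with $\mathcal C(\alpha,\gamma)=\mathcal M$ which has the smallest $\alpha$ and, among the pairs with this $\alpha$, the smallest $\gamma$. Let $\frac1{n-k}\le\epsilon\le1$. Then the MSR point exists and has $\alpha=\mathcal M/k$. If moreover $n_I\le k$ (or $\epsilon=1$), then the MSR point is $$(\alpha,\gamma)=\left(\frac{\mathcal M}{k},\ \frac{\mathcal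 M}{k}\cdot\frac{n-n_I+(n_I-1)/\epsilon}{n-k}\right),$$ and, with the normalization $\beta_c=1$, the parameters $(\alpha,\beta_I)$ give the MSR point for file size $\mathcal M$ if and only if $\alpha=n-k$, $\beta_I=1/\epsilon$ and $\mathcal M=k(n-k)$. -/

import Mathlib

open scoped ENNReal

noncomputable section

/-- A storage node of a clustered system: the `j`-th node of cluster `l` is `(l, j)`. There are `L`
clusters of `nI` nodes each, hence `L * nI` nodes in total. -/
abbrev StorageNode (L nI : ℕ) : Type := Fin L × Fin nI

/-- The states that the nodes pass through during `T` successive repairs: `Sum.inl v` is the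
original state of node `v`, and `Sum.inr t` is the newcomer created by the `t`-th repair. -/
abbrev NodeState (L nI T : ℕ) : Type := StorageNode L nI ⊕ Fin T

/-- The physical node to which a state belongs, when the `t`-th failed (and repaired) node
is `f t`. -/
def NodeState.node {L nI T : ℕ} (f : Fin T → StorageNode L nI) :
    NodeState L nI T → StorageNode L nI
  | Sum.inl v => v
  | Sum.inr t => f t

/-- The state `a` is the current state of its node after the repairs with index `< t`
(and before the repairs with index `≥ t`). -/
def NodeState.IsCurrent {L nI T : ℕ} (f : Fin T → StorageNode L nI) (t : ℕ) :
    NodeState L nI T → Prop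
  | Sum.inl v => ∀ s : Fin T, s.val < t → f s ≠ v
  | Sum.inr r => r.val < t ∧ ∀ s : Fin T, r < s → s.val < t → f s ≠ f r

/-- Vertices of an information flow graph: the source, the data collector, and an input and an
output vertex for every state of every node. -/
inductive FlowVertex (L nI T : ℕ) : Type
  | source : FlowVertex L nI T
  | collector : FlowVertex L nI T
  | input : NodeState L nI T → FlowVertex L nI T
  | output : NodeState L nI T → FlowVertex L nI T
  deriving DecidableEq, Fintype

open Classical in
/-- Edge capacities of the information flow graph in which the nodes `f 0, f 1, …, f (T - 1)` fail
and are repaired in this order, and then a data collector contacts the nodes in `K`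
(`0` means that there is no edge).
* The source feeds the original nodes through edges of infinite capacity.
* Each node stores `α`: input to output edges have capacity `α`.
* The newcomer of the `t`-th repair is helped by the current states of all the other nodes,
  through edges of capacity `βI` from its own cluster and `βc` from the other clusters.
* The data collector is joined to the current states of the nodes in `K` by edges of infinite
  capacity. -/
def flowEdge {L nI T : ℕ} (f : Fin T → StorageNode L nI) (K : Finset (StorageNode L nI))
    (α βI βc : ℝ) : FlowVertex L nI T → FlowVertex L nI T → ℝ≥0∞
  | .source, .input (Sum.inl _) => ⊤
  | .input a, .output b => if a = b then ENNReal.ofReal α else 0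
  | .output a, .input (Sum.inr t) =>
      if NodeState.IsCurrent f t.val a ∧ NodeState.node f a ≠ f t then
        if (NodeState.node f a).1 = (f t).1 then ENNReal.ofReal βI else ENNReal.ofReal βc
      else 0
  | .output a, .collector =>
      if NodeState.IsCurrent f T a ∧ NodeState.node f a ∈ K then ⊤ else 0
  | _, _ => 0

/-- The minimum value of a cut separating `s` from `t`, for edge capacities `c`. -/
def minCut {V : Type} [Fintype V] [DecidableEq V] (c : V → V → ℝ≥0∞) (s t : V) : ℝ≥0∞ :=
  ⨅ (S : Finset V) (_ : s ∈ S) (_ : t ∉ S), ∑ u ∈ S, ∑ v ∈ Sᶜ, c u v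

/-- The storage capacity of the clustered system: the amount of data that can be retrieved whatever
the sequence of failures and whichever `k` nodes are contacted, i.e. the minimum, over all
information flow graphs, of the minimum cut between source and data collector. -/
def storageCapacity (L nI k : ℕ) (α βI βc : ℝ) : ℝ≥0∞ :=
  ⨅ (T : ℕ) (f : Fin T → StorageNode L nI) (K : Finset (StorageNode L nI)) (_ : K.card = k),
    minCut (flowEdge f K α βI βc) FlowVertex.source FlowVertex.collector

/-- Repair bandwidth `γ = (nI - 1) βI + (n - nI) βc`, where `n = L * nI`. -/
def repairBandwidth (L nI : ℕ) (βI βc : ℝ) : ℝ :=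
  ((nI : ℝ) - 1) * βI + (((L * nI : ℕ) : ℝ) - (nI : ℝ)) * βc

/-- The pair `(α, γ)` satisfies `C(α, γ) = M` for the ratio `ε = βc / βI`. -/
def IsFeasiblePair (L nI k : ℕ) (ε M α γ : ℝ) : Prop :=
  0 ≤ α ∧ ∃ βI βc : ℝ, 0 ≤ βI ∧ βc = ε * βI ∧ γ = repairBandwidth L nI βI βc ∧
    storageCapacity L nI k α βI βc = ENNReal.ofReal M

/-- `(α, γ)` is the minimum-storage-regenerating point: `α` is the minimum node capacity among all
feasible pairs, and `γ` is the minimum repair bandwidth among the feasible pairs with that `α`. -/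
def IsMSRPoint (L nI k : ℕ) (ε M α γ : ℝ) : Prop :=
  IsFeasiblePair L nI k ε M α γ ∧
  (∀ α' γ' : ℝ, IsFeasiblePair L nI k ε M α' γ' → α ≤ α') ∧
  (∀ γ' : ℝ, IsFeasiblePair L nI k ε M α γ' → γ ≤ γ')

end

/-! Write n = L * nI. Contacting k nodes before any failure gives capacity at most kα, so α ≥ M/k
(`storageCapacity_le_mul`). Conversely, kα is reached once α ≤ (n - k)βc and βc ≤ βI
(`le_storageCapacity`). In a finite cut, at least k states have their output on the sink side; each
of the k oldest costs at least α. Either its storage edge is cut, or it is an original state fed by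
an infinite edge, or it is a newcomer. A newcomer's sink-side helpers are older, hence among the
other k - 1 chosen states, so at least n - k helpers feed it across the cut. If a whole cluster fits
into k nodes, or all links are equal, one repair of a contacted node yields a cut of value (k - 1)α
+ (n - k)βc (`storageCapacity_le_of_card_le`). The threshold α ≤ (n - k)βc is then sharp and
determines the least γ. In general the least γ exists because the admissible βI form a closed set.
-/

/-! ### Lower bound for all cuts -/

open Classical in
/-- Every finite set with at least `k` elements contains `k` elements that come first
with respect to a rank function. -/
theorem Finset.exists_initial_subset_card_eq {ι : Type*} (r : ι → ℕ) (k : ℕ) (A : Finset ι)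
    (hA : k ≤ A.card) :
    ∃ B ⊆ A, B.card = k ∧ ∀ b ∈ B, ∀ a ∈ A, r a < r b → a ∈ B := by
  obtain ⟨d, hd⟩ := Nat.exists_eq_add_of_le hA
  induction d generalizing A with
  | zero => exact ⟨A, subset_rfl, by simpa using hd, fun _ _ a ha _ => ha⟩
  | succ d ih =>
    have hne : A.Nonempty := Finset.card_pos.1 (by omega)
    obtain ⟨m, hm, hmax⟩ := A.exists_max_image r hne
    have hcard : (A.erase m).card = k + d := by
      rw [Finset.card_erase_of_mem hm]; omega
    obtain ⟨B, hBA, hB, hinit⟩ := ih (A.erase m) (by omega) hcard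
    refine ⟨B, hBA.trans (Finset.erase_subset _ _), hB, fun b hb a ha hab => ?_⟩
    refine hinit b hb a (Finset.mem_erase.2 ⟨?_, ha⟩) hab
    rintro rfl
    have := hmax b (Finset.mem_of_mem_erase (hBA hb))
    omega

/-- At every time, every node has a current state. -/
theorem NodeState.exists_isCurrent {L nI T : ℕ} (f : Fin T → StorageNode L nI) (t : ℕ)
    (v : StorageNode L nI) :
    ∃ a : NodeState L nI T, NodeState.IsCurrent f t a ∧ NodeState.node f a = v := by
  classical
  -- The last repair of `v` before time `t`, if there is one, creates its current state.
  let R : Finset (Fin T) := Finset.univ.filter fun s => s.val < t ∧ f s = v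
  by_cases hR : R.Nonempty
  · obtain ⟨m, hm, hmax⟩ := R.exists_max_image id hR
    simp only [R, Finset.mem_filter, Finset.mem_univ, true_and, id] at hm hmax
    refine ⟨Sum.inr m, ⟨hm.1, fun s hms hst hs => ?_⟩, hm.2⟩
    exact absurd (hmax s ⟨hst, hs.trans hm.2⟩) (not_le.2 hms)
  · refine ⟨Sum.inl v, fun s hst hs => hR ⟨s, ?_⟩, rfl⟩
    simp [R, hst, hs]

/-- The creation time of a state. -/
def NodeState.birth {L nI T : ℕ} : NodeState L nI T → ℕ
  | Sum.inl _ => 0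
  | Sum.inr t => t.val + 1

theorem NodeState.IsCurrent.birth_le {L nI T : ℕ} {f : Fin T → StorageNode L nI} {t : ℕ}
    {a : NodeState L nI T} (h : NodeState.IsCurrent f t a) : a.birth ≤ t := by
  cases a with
  | inl v => exact Nat.zero_le _
  | inr r => exact h.1

/-- If any `n - k` helpers already transmit `α`, then every cut is at least `k * α`. -/
theorem le_storageCapacity {L nI k : ℕ} {α βI βc : ℝ} (hk : k ≤ L * nI)
    (hβ : βc ≤ βI) (hα : α ≤ ((L * nI : ℕ) - k : ℝ) * βc) :
    k * ENNReal.ofReal α ≤ storageCapacity L nI k α βI βc := by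
  classical
  refine le_iInf fun T => le_iInf fun f => le_iInf fun K => le_iInf fun hK => ?_
  refine le_iInf fun S => le_iInf fun hs => le_iInf fun hc => ?_
  choose cur hcur hnode using NodeState.exists_isCurrent f
  by_cases hcut : ∃ v ∈ K, FlowVertex.output (cur T v) ∈ S
  · obtain ⟨v, hv, hvS⟩ := hcut
    have h1 : flowEdge f K α βI βc (.output (cur T v)) .collector = ⊤ := by
      simp [flowEdge, hcur, hnode, hv]
    have h2 := Finset.single_le_sum (f := fun w => flowEdge f K α βI βc (.output (cur T v)) w)
      (fun _ _ => zero_le) (Finset.mem_compl.2 hc)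
    have h3 := Finset.single_le_sum
      (f := fun u => ∑ w ∈ Sᶜ, flowEdge f K α βI βc u w) (fun _ _ => zero_le) hvS
    rw [h1] at h2
    exact le_top.trans (h2.trans h3)
  push Not at hcut
  -- No infinite edge into the collector is cut, so the k contacted states all have their outputs on
  -- the sink side.
  let A : Finset (NodeState L nI T) := Finset.univ.filter fun a => FlowVertex.output a ∉ S
  have hA : k ≤ A.card := by
    rw [← hK]
    refine Finset.card_le_card_of_injOn (cur T) (fun v hv => ?_) fun v _ w _ h => ?_
    · simpa [A] using hcut v hv
    · rw [← hnode T v, h, hnode]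
  obtain ⟨B, hBA, hB, hinit⟩ := A.exists_initial_subset_card_eq NodeState.birth k hA
  -- The sink-side vertex of a state whose incoming cut edges are charged; injectivity keeps the k
  -- charges disjoint.
  let φ : NodeState L nI T → FlowVertex L nI T := fun a =>
    if FlowVertex.input a ∈ S then .output a else .input a
  have hφ : Function.Injective φ := by
    intro a b h
    simp only [φ] at h
    split_ifs at h <;> simpa using h
  have hφS : ∀ b ∈ B, φ b ∈ Sᶜ := by
    intro b hb
    have := hBA hb
    simp only [A, Finset.mem_filter, Finset.mem_univ, true_and] at this
    simp only [φ]
    split_ifs with h <;> simpa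
  have key : ∀ b ∈ B, ENNReal.ofReal α ≤ ∑ u ∈ S, flowEdge f K α βI βc u (φ b) := by
    intro b hb
    by_cases hbS : FlowVertex.input b ∈ S
    · have := Finset.single_le_sum (f := fun u => flowEdge f K α βI βc u (φ b))
        (fun _ _ => zero_le) hbS
      simpa [φ, hbS, flowEdge] using this
    · simp only [φ, if_neg hbS]
      cases b with
      | inl v =>
        have := Finset.single_le_sum
          (f := fun u => flowEdge f K α βI βc u (.input (Sum.inl v))) (fun _ _ => zero_le) hs
        exact le_top.trans this
      | inr t =>
        let N : Finset (StorageNode L nI) :=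
          Finset.univ.filter fun v => v ≠ f t ∧ FlowVertex.output (cur t v) ∈ S
        let N' : Finset (StorageNode L nI) :=
          Finset.univ.filter fun v => v ≠ f t ∧ FlowVertex.output (cur t v) ∉ S
        have hinj : Function.Injective (cur t) := fun v w h => by
          rw [← hnode t v, h, hnode]
        have hN' : N'.card + 1 ≤ k := by
          have h1 : N'.card ≤ (B.erase (Sum.inr t)).card := by
            refine Finset.card_le_card_of_injOn (cur t) (fun v hv => ?_) hinj.injOn
            simp only [N', Finset.coe_filter, Finset.mem_univ, true_and, Set.mem_ofPred_eq] at hv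
            -- A helper of repair `t` has birth at most `t`, while the newcomer has birth `t + 1`:
            -- the shift in `birth` makes the inequality strict, so `hinit` puts sink-side helpers
            -- into `B`.
            have hlt : (cur t v).birth < NodeState.birth (Sum.inr t : NodeState L nI T) :=
              Nat.lt_succ_of_le (hcur t v).birth_le
            refine Finset.mem_coe.2 (Finset.mem_erase.2 ⟨fun h => ?_, ?_⟩)
            · rw [h] at hlt; exact lt_irrefl _ hlt
            · exact hinit _ hb _ (by simpa [A] using hv.2) hlt
          rw [Finset.card_erase_of_mem hb] at h1
          have := Finset.card_pos.2 ⟨_, hb⟩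
          omega
        have hNN' : N.card + N'.card + 1 = L * nI := by
          have h1 : N.card + N'.card = (Finset.univ.erase (f t)).card := by
            rw [← Finset.card_union_of_disjoint]
            · congr 1
              ext v
              simp only [N, N', Finset.mem_union, Finset.mem_filter, Finset.mem_erase,
                Finset.mem_univ]
              tauto
            · rw [Finset.disjoint_left]
              intro v
              simp only [N, N', Finset.mem_filter]
              tauto
          have h2 : (Finset.univ : Finset (StorageNode L nI)).card = L * nI := by simp
          have h3 := Finset.card_pos.2 ⟨f t, Finset.mem_univ (f t)⟩
          rw [Finset.card_erase_of_mem (Finset.mem_univ _)] at h1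
          omega
        have hN : L * nI - k ≤ N.card := by omega
        calc ENNReal.ofReal α
            ≤ ENNReal.ofReal (((L * nI - k : ℕ) : ℝ) * βc) := by
              rw [Nat.cast_sub hk]; exact ENNReal.ofReal_le_ofReal hα
          _ = ((L * nI - k : ℕ) : ℝ≥0∞) * ENNReal.ofReal βc := by
              rw [ENNReal.ofReal_mul (Nat.cast_nonneg _), ENNReal.ofReal_natCast]
          _ ≤ N.card * ENNReal.ofReal βc := by gcongr
          _ = ∑ v ∈ N, ENNReal.ofReal βc := by simp
          _ ≤ ∑ v ∈ N, flowEdge f K α βI βc (.output (cur t v)) (.input (Sum.inr t)) := by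
              refine Finset.sum_le_sum fun v hv => ?_
              simp only [N, Finset.mem_filter] at hv
              simp only [flowEdge, hcur, hnode, true_and, if_pos hv.2.1]
              split_ifs
              · exact ENNReal.ofReal_le_ofReal hβ
              · exact le_rfl
          _ = ∑ u ∈ N.image fun v => FlowVertex.output (cur t v),
                flowEdge f K α βI βc u (.input (Sum.inr t)) := by
              rw [Finset.sum_image]
              intro v _ w _ h
              exact hinj (FlowVertex.output.inj h)
          _ ≤ _ := by
              refine Finset.sum_le_sum_of_subset fun u hu => ?_
              obtain ⟨v, hv, rfl⟩ := Finset.mem_image.1 hu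
              exact (Finset.mem_filter.1 hv).2.2
  calc k * ENNReal.ofReal α = ∑ b ∈ B, ENNReal.ofReal α := by simp [hB]
    _ ≤ ∑ b ∈ B, ∑ u ∈ S, flowEdge f K α βI βc u (φ b) := Finset.sum_le_sum key
    _ = ∑ v ∈ B.image φ, ∑ u ∈ S, flowEdge f K α βI βc u v := by
        rw [Finset.sum_image hφ.injOn]
    _ ≤ ∑ v ∈ Sᶜ, ∑ u ∈ S, flowEdge f K α βI βc u v := by
        refine Finset.sum_le_sum_of_subset fun v hv => ?_
        obtain ⟨b, hb, rfl⟩ := Finset.mem_image.1 hv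
        exact hφS b hb
    _ = _ := Finset.sum_comm

/-! ### Upper bounds from explicit cuts -/

/-- The capacity is at most the value of any cut, given here by its sink side `D`. -/
theorem storageCapacity_le_cut {L nI k T : ℕ} {α βI βc : ℝ} (f : Fin T → StorageNode L nI)
    (K : Finset (StorageNode L nI)) (hK : K.card = k) (D : Finset (FlowVertex L nI T))
    (hs : .source ∉ D) (hc : .collector ∈ D) :
    storageCapacity L nI k α βI βc ≤ ∑ v ∈ D, ∑ u ∈ Dᶜ, flowEdge f K α βI βc u v := by
  refine iInf_le_of_le T <| iInf_le_of_le f <| iInf_le_of_le K <| iInf_le_of_le hK <|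
    iInf_le_of_le Dᶜ <| iInf_le_of_le (by simpa using hs) <|
    iInf_le_of_le (by simpa using hc) ?_
  rw [Finset.sum_comm, compl_compl]

/-- A state stores at most `α`. -/
theorem sum_flowEdge_output_le {L nI T : ℕ} {α βI βc : ℝ} (f : Fin T → StorageNode L nI)
    (K : Finset (StorageNode L nI)) (S : Finset (FlowVertex L nI T)) (a : NodeState L nI T) :
    ∑ u ∈ S, flowEdge f K α βI βc u (.output a) ≤ ENNReal.ofReal α := by
  have h : ∀ u, flowEdge f K α βI βc u (.output a)
      = if u = .input a then ENNReal.ofReal α else 0 := by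
    rintro (_ | _ | b | b) <;> simp [flowEdge]
  simp only [h, Finset.sum_ite_eq']
  split_ifs <;> simp

/-- With no failures, the sink side made of the collector and the k contacted outputs cuts only k
storage edges. -/
theorem storageCapacity_le_mul {L nI k : ℕ} (hk : k ≤ L * nI) (α βI βc : ℝ) :
    storageCapacity L nI k α βI βc ≤ k * ENNReal.ofReal α := by
  classical
  obtain ⟨K, -, hK⟩ := Finset.exists_subset_card_eq
    (s := (Finset.univ : Finset (StorageNode L nI))) (n := k) (by simpa using hk)
  let f : Fin 0 → StorageNode L nI := Fin.elim0
  let O : Finset (FlowVertex L nI 0) := K.image fun v => .output (Sum.inl v)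
  have hO : FlowVertex.collector ∉ O := by simp [O]
  refine (storageCapacity_le_cut f K hK (insert .collector O) (by simp [O]) (by simp)).trans ?_
  rw [Finset.sum_insert hO, Finset.sum_eq_zero, zero_add, Finset.sum_image]
  · refine (Finset.sum_le_sum fun v _ => sum_flowEdge_output_le f K _ _).trans ?_
    simp [hK]
  · intro v _ w _ h
    simpa using h
  · rintro (_ | _ | a | a) hu
    · rfl
    · rfl
    · rfl
    · obtain v | t := a
      · simp only [O, Finset.mem_compl, Finset.mem_insert, Finset.mem_image, reduceCtorEq,
          false_or, FlowVertex.output.injEq, Sum.inl.injEq, exists_eq_right] at hu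
        simp [flowEdge, NodeState.node, hu]
      · exact t.elim0

/-- After the repair of one contacted node all of whose uncontacted helpers send `βc`,
the cut through the newcomer's incoming edges is `(k - 1) * α + (n - k) * βc`. -/
theorem storageCapacity_le_of_card_le {L nI k : ℕ} (hk : 1 ≤ k) (hkn : k < L * nI)
    {α βI βc : ℝ} (h : nI ≤ k ∨ βI = βc) :
    storageCapacity L nI k α βI βc
      ≤ (k - 1 : ℕ) * ENNReal.ofReal α + (L * nI - k : ℕ) * ENNReal.ofReal βc := by
  classical
  have hL : 0 < L := Nat.pos_of_ne_zero (by rintro rfl; simp at hkn)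
  have hnI : 0 < nI := Nat.pos_of_ne_zero (by rintro rfl; simp at hkn)
  let x : StorageNode L nI := (⟨0, hL⟩, ⟨0, hnI⟩)
  -- If nI ≤ k, `K` contains the whole cluster of `x`, so every uncontacted helper lies in another
  -- cluster.
  obtain ⟨K, hxK, hK, hcl⟩ : ∃ K : Finset (StorageNode L nI), x ∈ K ∧ K.card = k ∧
      ∀ v ∉ K, v.1 = x.1 → βI = βc := by
    rcases h with h | h
    · let C : Finset (StorageNode L nI) := {x.1} ×ˢ Finset.univ
      obtain ⟨K, hCK, -, hK⟩ := Finset.exists_subsuperset_card_eq (n := k)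
        (Finset.subset_univ C) (by simpa [C] using h) (by simpa using hkn.le)
      refine ⟨K, hCK (by simp [C]), hK, fun v hv hvx => absurd (hCK ?_) hv⟩
      exact Finset.mem_product.2 ⟨Finset.mem_singleton.2 hvx, Finset.mem_univ _⟩
    · obtain ⟨K, hxK, -, hK⟩ := Finset.exists_subsuperset_card_eq (n := k)
        (Finset.subset_univ {x}) (by simpa using hk) (by simpa using hkn.le)
      exact ⟨K, hxK (by simp), hK, fun _ _ _ => h⟩
  let f : Fin 1 → StorageNode L nI := fun _ => x
  let O : Finset (FlowVertex L nI 1) := (K.erase x).image fun v => .output (Sum.inl v)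
  -- Links from contacted helpers start inside `D`. Only the k - 1 other storage edges and the links
  -- from the n - k uncontacted helpers are cut.
  let D : Finset (FlowVertex L nI 1) :=
    insert .collector (insert (.input (Sum.inr 0)) (insert (.output (Sum.inr 0)) O))
  have hc : FlowVertex.collector ∉
      insert (FlowVertex.input (Sum.inr 0)) (insert (.output (Sum.inr 0)) O) := by simp [O]
  have hi : FlowVertex.input (Sum.inr 0) ∉ insert (FlowVertex.output (Sum.inr 0)) O := by
    simp [O]
  have ho : FlowVertex.output (Sum.inr 0) ∉ O := by simp [O]
  have hDinl : ∀ v, FlowVertex.output (Sum.inl v) ∈ Dᶜ ↔ (v ∈ K → v = x) := by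
    intro v
    simp only [D, O, Finset.mem_compl, Finset.mem_insert, Finset.mem_image, reduceCtorEq,
      false_or, FlowVertex.output.injEq, Sum.inl.injEq, exists_eq_right, Finset.mem_erase]
    tauto
  have hDinr : ∀ t : Fin 1, FlowVertex.output (Sum.inr t) ∉ Dᶜ := by
    intro t
    rw [Subsingleton.elim t 0]
    simp [D]
  have hDinr' : ∀ t : Fin 1, FlowVertex.input (Sum.inr t) ∉ Dᶜ := by
    intro t
    rw [Subsingleton.elim t 0]
    simp [D]
  refine (storageCapacity_le_cut f K hK D (by simp [D, O]) (by simp [D])).trans ?_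
  have hcol : ∑ u ∈ Dᶜ, flowEdge f K α βI βc u .collector = 0 := by
    refine Finset.sum_eq_zero ?_
    rintro (_ | _ | a | (v | t)) hu
    · rfl
    · rfl
    · rfl
    · have hv := (hDinl v).1 hu
      -- The only contacted original output outside `D` is that of `x`, which is no longer current
      -- after the repair.
      refine if_neg fun hcur => ?_
      exact hcur.1 0 Nat.one_pos (hv hcur.2).symm
    · exact absurd hu (hDinr t)
  have hout : ∑ u ∈ Dᶜ, flowEdge f K α βI βc u (.output (Sum.inr 0)) = 0 := by
    refine Finset.sum_eq_zero ?_
    rintro (_ | _ | (v | t) | a) hu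
    · rfl
    · rfl
    · simp [flowEdge]
    · exact absurd hu (hDinr' t)
    · rfl
  have hin : ∑ u ∈ Dᶜ, flowEdge f K α βI βc u (.input (Sum.inr 0))
      ≤ (L * nI - k : ℕ) * ENNReal.ofReal βc := by
    have hle : ∑ u ∈ Dᶜ, flowEdge f K α βI βc u (.input (Sum.inr 0))
        ≤ ∑ u ∈ Kᶜ.image fun v => FlowVertex.output (Sum.inl v),
          flowEdge f K α βI βc u (.input (Sum.inr 0)) := by
      refine Finset.sum_le_sum_of_ne_zero ?_
      rintro (_ | _ | a | (v | t)) hu hne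
      · exact absurd rfl hne
      · exact absurd rfl hne
      · exact absurd rfl hne
      · have hv := (hDinl v).1 hu
        refine Finset.mem_image_of_mem _ (Finset.mem_compl.2 fun hvK => hne ?_)
        refine if_neg fun hcur => hcur.2 (hv hvK)
      · exact absurd hu (hDinr t)
    refine hle.trans ?_
    rw [Finset.sum_image (fun v _ w _ h => by simpa using h)]
    have hcard : (Kᶜ).card = L * nI - k := by
      rw [Finset.card_compl, hK]; simp
    rw [← hcard, ← nsmul_eq_mul]
    refine Finset.sum_le_card_nsmul _ _ _ fun v hv => ?_
    have hcl' := hcl v (Finset.mem_compl.1 hv)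
    simp only [flowEdge]
    split_ifs with h1 h2
    · rw [hcl' h2]
    · exact le_rfl
    · exact zero_le
  simp only [D] at hcol hout hin ⊢
  rw [Finset.sum_insert hc, Finset.sum_insert hi, Finset.sum_insert ho, hcol, hout, zero_add,
    zero_add, add_comm]
  refine add_le_add ?_ hin
  rw [Finset.sum_image (fun v _ w _ h => by simpa using h)]
  refine (Finset.sum_le_sum fun v _ => sum_flowEdge_output_le f K _ _).trans ?_
  simp [Finset.card_erase_of_mem hxK, hK]

/-! ### Feasible pairs and the MSR point -/

/-- The capacity is an infimum, over infinitely many graphs, of finite sums continuous in β, so its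
superlevel sets are intersections of closed sets. This makes the least bandwidth attained. -/
theorem isClosed_le_storageCapacity (L nI k : ℕ) (α ε : ℝ) (m : ℝ≥0∞) :
    IsClosed {β : ℝ | m ≤ storageCapacity L nI k α β (ε * β)} := by
  simp only [storageCapacity, minCut, le_iInf_iff, Set.ofPred_forall]
  refine isClosed_iInter fun T => isClosed_iInter fun f => isClosed_iInter fun K =>
    isClosed_iInter fun _ => isClosed_iInter fun S => isClosed_iInter fun _ =>
    isClosed_iInter fun _ => isClosed_le continuous_const ?_
  refine continuous_finsetSum _ fun u _ => continuous_finsetSum _ fun v _ => ?_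
  have h1 : Continuous fun β : ℝ => ENNReal.ofReal β := ENNReal.continuous_ofReal
  have h2 : Continuous fun β : ℝ => ENNReal.ofReal (ε * β) :=
    ENNReal.continuous_ofReal.comp (continuous_const.mul continuous_id)
  rcases u with _ | _ | a | a <;> rcases v with _ | _ | (b | b) | b <;>
    simp only [flowEdge] <;> first | exact continuous_const | split_ifs <;>
    first | exact continuous_const | exact h1 | exact h2

theorem repairBandwidth_mul (L nI : ℕ) (ε β : ℝ) :
    repairBandwidth L nI β (ε * β) =
      (((nI : ℝ) - 1) + (((L * nI : ℕ) : ℝ) - nI) * ε) * β := by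
  unfold repairBandwidth; ring

/-- For nI ≥ 2 the first term is positive; for nI = 1 the second is, since n > 1. Minimizing γ thus
amounts to minimizing βI. -/
theorem repairBandwidth_coeff_pos {L nI : ℕ} {ε : ℝ} (hn : 1 < L * nI) (hε : 0 < ε) :
    0 < ((nI : ℝ) - 1) + (((L * nI : ℕ) : ℝ) - nI) * ε := by
  have hnI : 0 < nI := Nat.pos_of_ne_zero (by rintro rfl; simp at hn)
  have hL : 0 < L := Nat.pos_of_ne_zero (by rintro rfl; simp at hn)
  have h1 : (1 : ℝ) ≤ nI := by exact_mod_cast hnI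
  have h2 : (nI : ℝ) ≤ (L * nI : ℕ) := by exact_mod_cast Nat.le_mul_of_pos_left nI hL
  have h3 : (1 : ℝ) < (L * nI : ℕ) := by exact_mod_cast hn
  rcases h1.lt_or_eq with h | h
  · have := mul_nonneg (sub_nonneg.2 h2) hε.le
    linarith
  · rw [← h] at h2 ⊢
    have := mul_pos (sub_pos.2 h3) hε
    linarith

/-- At α = M/k the bound kα is M itself, so equality of the capacity with M reduces to one
inequality. -/
theorem isFeasiblePair_div_iff {L nI k : ℕ} (hk : 1 ≤ k) (hkn : k ≤ L * nI) {ε M γ : ℝ}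
    (hM : 0 < M) :
    IsFeasiblePair L nI k ε M (M / k) γ ↔ ∃ β : ℝ, 0 ≤ β ∧
      γ = (((nI : ℝ) - 1) + (((L * nI : ℕ) : ℝ) - nI) * ε) * β ∧
      ENNReal.ofReal M ≤ storageCapacity L nI k (M / k) β (ε * β) := by
  have hk0 : (0 : ℝ) < k := by exact_mod_cast hk
  have hup : ∀ β, storageCapacity L nI k (M / k) β (ε * β) ≤ ENNReal.ofReal M := fun β => by
    refine (storageCapacity_le_mul hkn _ _ _).trans_eq ?_
    rw [← ENNReal.ofReal_natCast, ← ENNReal.ofReal_mul hk0.le, mul_div_cancel₀ _ hk0.ne']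
  constructor
  · rintro ⟨-, β, _, hβ, rfl, rfl, hC⟩
    exact ⟨β, hβ, repairBandwidth_mul _ _ _ _, hC.ge⟩
  · rintro ⟨β, hβ, rfl, hC⟩
    exact ⟨by positivity, β, _, hβ, rfl, (repairBandwidth_mul _ _ _ _).symm,
      le_antisymm (hup β) hC⟩

theorem IsFeasiblePair.div_le {L nI k : ℕ} (hk : 1 ≤ k) (hkn : k ≤ L * nI) {ε M α γ : ℝ}
    (h : IsFeasiblePair L nI k ε M α γ) : M / k ≤ α := by
  have hk0 : (0 : ℝ) < k := by exact_mod_cast hk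
  obtain ⟨hα, β, _, -, -, -, hC⟩ := h
  have hle := hC.symm.trans_le (storageCapacity_le_mul hkn _ _ _)
  rw [← ENNReal.ofReal_natCast, ← ENNReal.ofReal_mul hk0.le,
    ENNReal.ofReal_le_ofReal_iff (by positivity)] at hle
  rwa [div_le_iff₀' hk0]

theorem ofReal_le_storageCapacity {L nI k : ℕ} (hk : 1 ≤ k) (hkn : k < L * nI) {ε M β : ℝ}
    (hε1 : ε ≤ 1) (hβ : 0 ≤ β)
    (h : M / k ≤ (((L * nI : ℕ) : ℝ) - k) * (ε * β)) :
    ENNReal.ofReal M ≤ storageCapacity L nI k (M / k) β (ε * β) := by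
  have hk0 : (0 : ℝ) < k := by exact_mod_cast hk
  refine le_trans (le_of_eq ?_) (le_storageCapacity hkn.le (mul_le_of_le_one_left hβ hε1) h)
  rw [← ENNReal.ofReal_natCast, ← ENNReal.ofReal_mul hk0.le, mul_div_cancel₀ _ hk0.ne']

/-- For necessity, M ≤ (k - 1)M/k + (n - k)εβ by the single-repair cut, and (k - 1)M/k is
subtracted. -/
theorem ofReal_le_storageCapacity_iff {L nI k : ℕ} (hk : 1 ≤ k) (hkn : k < L * nI)
    {ε M β : ℝ} (hM : 0 < M) (hε : 0 < ε) (hε1 : ε ≤ 1) (hβ : 0 ≤ β) (h : nI ≤ k ∨ ε = 1) :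
    ENNReal.ofReal M ≤ storageCapacity L nI k (M / k) β (ε * β) ↔
      M / k ≤ (((L * nI : ℕ) : ℝ) - k) * (ε * β) := by
  refine ⟨fun hC => ?_, ofReal_le_storageCapacity hk hkn hε1 hβ⟩
  have hk0 : (0 : ℝ) < k := by exact_mod_cast hk
  have hk1 : (0 : ℝ) ≤ (k : ℝ) - 1 := by rw [sub_nonneg]; exact_mod_cast hk
  have hnk : (0 : ℝ) < ((L * nI : ℕ) : ℝ) - k := sub_pos.2 (by exact_mod_cast hkn)
  have hle := hC.trans (storageCapacity_le_of_card_le hk hkn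
    (h.imp_right fun h => by rw [h, one_mul]))
  rw [← ENNReal.ofReal_natCast, ← ENNReal.ofReal_natCast, Nat.cast_sub hk,
    Nat.cast_sub hkn.le, Nat.cast_one, ← ENNReal.ofReal_mul hk1, ← ENNReal.ofReal_mul hnk.le,
    ← ENNReal.ofReal_add (by positivity) (mul_nonneg hnk.le (by positivity)),
    ENNReal.ofReal_le_ofReal_iff
      (add_nonneg (by positivity) (mul_nonneg hnk.le (by positivity)))] at hle
  have : (k : ℝ) * (M / k) = M := mul_div_cancel₀ _ hk0.ne'
  linarith

theorem exists_isMSRPoint {L nI k : ℕ} (hk : 1 ≤ k) (hkn : k < L * nI) {ε M : ℝ} (hM : 0 < M)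
    (hε : 0 < ε) (hε1 : ε ≤ 1) : ∃ γ, IsMSRPoint L nI k ε M (M / k) γ := by
  have hk0 : (0 : ℝ) < k := by exact_mod_cast hk
  have hnk : (0 : ℝ) < ((L * nI : ℕ) : ℝ) - k := sub_pos.2 (by exact_mod_cast hkn)
  let B : Set ℝ := {β | 0 ≤ β} ∩
    {β | ENNReal.ofReal M ≤ storageCapacity L nI k (M / k) β (ε * β)}
  have hB : IsClosed B :=
    (isClosed_le continuous_const continuous_id).inter (isClosed_le_storageCapacity ..)
  have hne : B.Nonempty := by
    -- This β solves (n - k)εβ = M/k, the sufficient condition with equality.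
    refine ⟨M / k / ((((L * nI : ℕ) : ℝ) - k) * ε), ?_, ?_⟩
    · change (0 : ℝ) ≤ _
      positivity
    refine ofReal_le_storageCapacity hk hkn hε1 (by positivity) (le_of_eq ?_)
    field_simp
  have hbdd : BddBelow B := ⟨0, fun β hβ => hβ.1⟩
  have hmem := hB.csInf_mem hne hbdd
  refine ⟨_, (isFeasiblePair_div_iff hk hkn.le hM).2 ⟨sInf B, hmem.1, rfl, hmem.2⟩,
    fun _ _ h => h.div_le hk hkn.le, fun γ' h => ?_⟩
  obtain ⟨β, hβ, rfl, hC⟩ := (isFeasiblePair_div_iff hk hkn.le hM).1 h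
  exact mul_le_mul_of_nonneg_left (csInf_le hbdd ⟨hβ, hC⟩)
    (repairBandwidth_coeff_pos (by omega) hε).le

theorem IsMSRPoint.unique {L nI k : ℕ} {ε M α γ α' γ' : ℝ} (h : IsMSRPoint L nI k ε M α γ)
    (h' : IsMSRPoint L nI k ε M α' γ') : α = α' ∧ γ = γ' := by
  obtain rfl : α = α' := le_antisymm (h.2.1 _ _ h'.1) (h'.2.1 _ _ h.1)
  exact ⟨rfl, le_antisymm (h.2.2 _ h'.1) (h'.2.2 _ h.1)⟩

theorem isMSRPoint_iff {L nI k : ℕ} (hk : 1 ≤ k) (hkn : k < L * nI) {ε M α γ : ℝ} (hM : 0 < M)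
    (hε : 0 < ε) (hε1 : ε ≤ 1) (h : nI ≤ k ∨ ε = 1) :
    IsMSRPoint L nI k ε M α γ ↔ α = M / k ∧
      γ = M / k * ((((L * nI : ℕ) : ℝ) - nI + ((nI : ℝ) - 1) / ε) /
        (((L * nI : ℕ) : ℝ) - k)) := by
  have hk0 : (0 : ℝ) < k := by exact_mod_cast hk
  have hnk : (0 : ℝ) < ((L * nI : ℕ) : ℝ) - k := sub_pos.2 (by exact_mod_cast hkn)
  set c := ((nI : ℝ) - 1) + (((L * nI : ℕ) : ℝ) - nI) * ε with hc
  have hcpos : 0 < c := repairBandwidth_coeff_pos (by omega) hε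
  -- The right side is the bandwidth at the threshold β = M/(k(n - k)ε).
  have hγ : M / k * ((((L * nI : ℕ) : ℝ) - nI + ((nI : ℝ) - 1) / ε) /
      (((L * nI : ℕ) : ℝ) - k)) = c * (M / k / ((((L * nI : ℕ) : ℝ) - k) * ε)) := by
    rw [hc]; field_simp; ring
  have hpt : IsMSRPoint L nI k ε M (M / k)
      (c * (M / k / ((((L * nI : ℕ) : ℝ) - k) * ε))) := by
    refine ⟨(isFeasiblePair_div_iff hk hkn.le hM).2 ⟨_, by positivity, rfl, ?_⟩,
      fun _ _ h => h.div_le hk hkn.le, fun γ' h' => ?_⟩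
    · refine ofReal_le_storageCapacity hk hkn hε1 (by positivity) (le_of_eq ?_)
      field_simp
    · obtain ⟨β, hβ, rfl, hC⟩ := (isFeasiblePair_div_iff hk hkn.le hM).1 h'
      rw [ofReal_le_storageCapacity_iff hk hkn hM hε hε1 hβ h] at hC
      refine mul_le_mul_of_nonneg_left ?_ hcpos.le
      rw [div_le_iff₀' (by positivity)]
      linarith
  rw [hγ]
  exact ⟨fun h' => h'.unique hpt, by rintro ⟨rfl, rfl⟩; exact hpt⟩

theorem proposition4 (n k L nI : ℕ) (hn : n = L * nI) (hk : 1 ≤ k) (hkn : k < n)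
    (ε M : ℝ) (hε : 1 / ((n : ℝ) - (k : ℝ)) ≤ ε) (hε1 : ε ≤ 1) (hM : 0 < M) :
    (∃ γ : ℝ, IsMSRPoint L nI k ε M (M / k) γ) ∧
    (nI ≤ k ∨ ε = 1 →
      (∀ α γ : ℝ, IsMSRPoint L nI k ε M α γ ↔
        α = M / k ∧
        γ = M / k * (((n : ℝ) - (nI : ℝ) + ((nI : ℝ) - 1) / ε) / ((n : ℝ) - (k : ℝ)))) ∧
      (∀ α βI βc : ℝ, βc = 1 →
        (βc = ε * βI ∧ IsMSRPoint L nI k ε M α (repairBandwidth L nI βI βc) ↔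
          α = (n : ℝ) - (k : ℝ) ∧ βI = 1 / ε ∧ M = (k : ℝ) * ((n : ℝ) - (k : ℝ))))) := by
  subst hn
  have hk0 : (0 : ℝ) < k := by exact_mod_cast hk
  have hnk : (0 : ℝ) < ((L * nI : ℕ) : ℝ) - k := sub_pos.2 (by exact_mod_cast hkn)
  have hε0 : 0 < ε := (one_div_pos.2 hnk).trans_le hε
  refine ⟨exists_isMSRPoint hk hkn hM hε0 hε1, fun h =>
    ⟨fun α γ => isMSRPoint_iff hk hkn hM hε0 hε1 h, ?_⟩⟩
  rintro α βI _ rfl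
  rw [isMSRPoint_iff hk hkn hM hε0 hε1 h]
  have hβ : 1 = ε * βI ↔ βI = 1 / ε := by
    rw [eq_div_iff hε0.ne', mul_comm βI]; exact eq_comm
  have hd : 0 < ((L * nI : ℕ) : ℝ) - nI + ((nI : ℝ) - 1) / ε := by
    have := div_pos (repairBandwidth_coeff_pos (L := L) (nI := nI) (by omega) hε0) hε0
    rwa [add_div, mul_div_cancel_right₀ _ hε0.ne', add_comm] at this
  have hbw : repairBandwidth L nI (1 / ε) 1 =
      ((L * nI : ℕ) : ℝ) - nI + ((nI : ℝ) - 1) / ε := by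
    unfold repairBandwidth; ring
  constructor
  · rintro ⟨h1, rfl, h2⟩
    obtain rfl := hβ.1 h1
    -- With βc = 1 the bandwidth is exactly the numerator in the formula for γ; cancelling it,
    -- positive by `hd`, leaves (M/k)/(n - k) = 1.
    rw [hbw, mul_div_left_comm] at h2
    have h3 := mul_left_cancel₀ hd.ne' ((mul_one _).trans h2)
    rw [eq_comm, div_eq_one_iff_eq hnk.ne'] at h3
    exact ⟨h3, rfl, by rw [← h3, mul_div_cancel₀ _ hk0.ne']⟩
  · rintro ⟨rfl, rfl, rfl⟩
    refine ⟨hβ.2 rfl, (mul_div_cancel_left₀ _ hk0.ne').symm, ?_⟩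
    rw [hbw, mul_div_cancel_left₀ _ hk0.ne', mul_div_cancel₀ _ hnk.ne']
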